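/- **Setting.** Let $t=(t_1,t_2,\dots)$, $\bar t=(\bar t_1,\bar t_2,\dots)$ be complex variables, $\Lambda=\begin{bmatrix}0&1\\ \zeta&0\end{bmatrix}$, $H_0=\mathrm{diag}(1,-1)$. Consider a triple of $2\times2$ matrices depending on $(t,\bar t)$ in some domain, $$g_{<0}=I+\sum_{n\ge1}W_n\Lambda^{-n},\qquad g_0=\exp\Phi,\qquad g_{>0}=I+\sum_{n\ge1}\bar W_n\Lambda^{n},$$ with $W_n,\bar W_n$ diagonal, $\Phi=\mathrm{diag}(\phi,-\phi)$, $\det g_{<0}=\det g_{>0}=1$, $W_1=\mathrm{diag}(q,r)$, $\bar W_1=\mathrm{diag}(\bar q,\bar r)$ (for instance the factors of a solution of the modified Pohlmeyer–Lund–Regge hierarchy). Put $t_\lambda=(\lambda^nt_n)_n$, $\bar t_{\lambda^{-1}}=(\lambda^{-n}\bar t_n)_n$. The triple satisfies the similarity conditions with parameters $\alpha,\beta\in\mathbb C$ if $$\begin{aligned}g_{<0}(\zeta;t,\bar t)&=\lambda^{\alpha H_0}g_{<0}(\lambda^{-1}\zeta;t_\lambda,\bar t_{\lambda^{-1}})\lambda^{-\alpha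 H_0},\\ g_0(t,\bar t)&=\lambda^{\alpha H_0}g_0(t_\lambda,\bar t_{\lambda^{-1}})\lambda^{-\beta H_0},\\ g_{>0}(\zeta;t,\bar t)&=\lambda^{\beta H_0}g_{>0}(\lambda^{-1}\zeta;t_\lambda,\bar t_{\lambda^{-1}})\lambda^{-\beta H_0}\end{aligned}$$ for all $\lambda=e^{\ell}$, $\lambda^a:=e^{a\ell}$, with $\ell\in\mathbb C$ such that $(t_{e^{s\ell}},\bar t_{e^{-s\ell}})$ stays in the domain for $0\le s\le1$. **Basic transformations.** Let $S_0=\begin{bmatrix}0&\zeta^{-1}\\-\zeta&0\end{bmatrix}$, $S_1=\begin{bmatrix}0&-1\\1&0\end{bmatrix}$, $P=\begin{bmatrix}0&\zeta^{-1/2}\\-\zeta^{1/2}&0\end{bmatrix}$. * $\sigma$ replaces $W_n(t,\bar t),\bar W_n(t,\bar t),\Phi(t,\bar t)$ by $\bar W_n(\bar t,t),W_n(\bar t,t),-\Phi(\bar t,t)$. * $s_i^{\mathrm L}$ ($i=0,1$) replaces $(g_{<0},g_0,g_{>0})(t,\bar t)$ by $(G_i\,g_{<0}\,S_i,\;G_i\,g_0\,\bar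 G_i^{-1},\;\bar G_i\,g_{>0})(-t,\bar t)$, where $G_0=\begin{bmatrix}-1/q&0\\ \zeta&-q\end{bmatrix}$, $\bar G_0=\begin{bmatrix}1&0\\-\zeta e^{2\phi}/q&1\end{bmatrix}$, $G_1=\begin{bmatrix}-r&1\\0&-1/r\end{bmatrix}$, $\bar G_1=\begin{bmatrix}1&-1/(re^{2\phi})\\0&1\end{bmatrix}$. * $s_i^{\mathrm R}$ ($i=0,1$) replaces $(g_{<0},g_0,g_{>0})(t,\bar t)$ by $(G_i'\,g_{<0},\;G_i'\,g_0\,\bar G_i'^{-1},\;\bar G_i'\,g_{>0}\,S_i)(t,-\bar t)$, where $G_0'=\begin{bmatrix}1&-\zeta^{-1}e^{2\phi}/\bar r\\0&1\end{bmatrix}$, $\bar G_0'=\begin{bmatrix}\bar r&-\zeta^{-1}\\0&1/\bar r\end{bmatrix}$, $G_1'=\begin{bmatrix}1&0\\-1/(\bar qe^{2\phi})&1\end{bmatrix}$, $\bar G_1'=\begin{bmatrix}1/\bar q&0\\-1&\bar q\end{bmatrix}$. * $\pi$ replaces each $g(t,\bar t)$ of the three matrices by $P^{-1}g(-t,-\bar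 t)P$. (The maps $s_0^{\mathrm L},s_1^{\mathrm L},s_0^{\mathrm R},s_1^{\mathrm R}$ are taken on the part of the domain where, at the transformed point, $q$, $r$, $\bar r$, $\bar q\neq0$ respectively.) **Theorem.** If the triple satisfies the similarity conditions with parameters $(\alpha,\beta)$, then each of its six transforms is again a triple of the above form, and satisfies the similarity conditions with the parameters $$\begin{array}{c|cc} & \alpha & \beta\\ \hline \sigma & -\beta-\frac12 & -\alpha-\frac12\\ s_0^{\mathrm L} & -\alpha-1 & \beta\\ s_1^{\mathrm L} & -\alpha & \beta\\ s_0^{\mathrm R} & \alpha & -\beta-1\\ s_1^{\mathrm R} & \alpha & -\beta\\ \pi & -\alpha-\frac12 & -\beta-\frac12\end{array}$$ -/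

import Mathlib

namespace MPLR

noncomputable section

/-- A point `(t, t̄)` with `t = (t₁, t₂, …)` and `t̄ = (t̄₁, t̄₂, …)`. -/
abbrev Times : Type := (ℕ+ → ℂ) × (ℕ+ → ℂ)

/-- Formal Laurent series in one variable. Entries of `g_{<0}` are series in the variable `ζ⁻¹`;
entries of `g_0` and `g_{>0}` are series in the variable `ζ`. -/
abbrev Ser : Type := LaurentSeries ℂ

/-- `2 × 2` matrices of formal Laurent series. -/
abbrev Mat : Type := Matrix (Fin 2) (Fin 2) Ser

/-- Constants. -/
abbrev cst (a : ℂ) : Ser := HahnSeries.C a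

/-- The element `ζ` among the Laurent series in the variable `ζ⁻¹`. -/
def zetaNeg : Ser := HahnSeries.single (-1) 1

/-- The element `ζ` among the Laurent series in the variable `ζ`. -/
def zetaPos : Ser := HahnSeries.single 1 1

/-- The substitution `X ↦ μ X` in a Laurent series in the variable `X`. -/
def rescale (μ : ℂ) (f : Ser) : Ser where
  coeff n := μ ^ n * f.coeff n
  isPWO_support' := f.isPWO_support.mono fun n hn => by
    simp only [Function.mem_support, HahnSeries.mem_support] at hn ⊢
    exact right_ne_zero_of_mul hn

/-- `∑_{n ≥ 0} W_n Λ⁻ⁿ`, where `W_n = diag (W n 0, W n 1)` and `Λ = !![0, 1; ζ, 0]`, so that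
`Λ⁻²ᵏ = ζ⁻ᵏ` and `Λ⁻²ᵏ⁻¹ = ζ⁻ᵏ !![0, ζ⁻¹; 1, 0]`. -/
def ofNegCoeff (W : ℕ → Fin 2 → ℂ) : Mat :=
  !![((PowerSeries.mk fun k => W (2 * k) 0 : PowerSeries ℂ) : Ser),
      zetaNeg⁻¹ * ((PowerSeries.mk fun k => W (2 * k + 1) 0 : PowerSeries ℂ) : Ser);
     ((PowerSeries.mk fun k => W (2 * k + 1) 1 : PowerSeries ℂ) : Ser),
      ((PowerSeries.mk fun k => W (2 * k) 1 : PowerSeries ℂ) : Ser)]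

/-- `∑_{n ≥ 0} W_n Λⁿ`, where `W_n = diag (W n 0, W n 1)` and `Λ = !![0, 1; ζ, 0]`. -/
def ofPosCoeff (W : ℕ → Fin 2 → ℂ) : Mat :=
  !![((PowerSeries.mk fun k => W (2 * k) 0 : PowerSeries ℂ) : Ser),
      ((PowerSeries.mk fun k => W (2 * k + 1) 0 : PowerSeries ℂ) : Ser);
     zetaPos * ((PowerSeries.mk fun k => W (2 * k + 1) 1 : PowerSeries ℂ) : Ser),
      ((PowerSeries.mk fun k => W (2 * k) 1 : PowerSeries ℂ) : Ser)]

/-- The diagonal coefficient of `Λ⁻ⁿ` in a matrix of series in `ζ⁻¹`. -/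
def negCoeff (A : Mat) (n : ℕ) : Fin 2 → ℂ :=
  if Even n then ![(A 0 0).coeff (n / 2 : ℕ), (A 1 1).coeff (n / 2 : ℕ)]
  else ![(A 0 1).coeff ((n / 2 : ℕ) + 1), (A 1 0).coeff (n / 2 : ℕ)]

/-- The diagonal coefficient of `Λⁿ` in a matrix of series in `ζ`. -/
def posCoeff (A : Mat) (n : ℕ) : Fin 2 → ℂ :=
  if Even n then ![(A 0 0).coeff (n / 2 : ℕ), (A 1 1).coeff (n / 2 : ℕ)]
  else ![(A 0 1).coeff (n / 2 : ℕ), (A 1 0).coeff ((n / 2 : ℕ) + 1)]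

/-- The group `exp 𝔫₋` of matrices `I + W₁ Λ⁻¹ + W₂ Λ⁻² + ⋯` of determinant one,
with diagonal `W_n`. -/
def NegGroup : Set Mat :=
  {A | (∃ W : ℕ → Fin 2 → ℂ, W 0 = 1 ∧ A = ofNegCoeff W) ∧ A.det = 1}

/-- The group `exp 𝔫₊` of matrices `I + W̄₁ Λ + W̄₂ Λ² + ⋯` of determinant one,
with diagonal `W̄_n`. -/
def PosGroup : Set Mat :=
  {A | (∃ W : ℕ → Fin 2 → ℂ, W 0 = 1 ∧ A = ofPosCoeff W) ∧ A.det = 1}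

/-- The group of matrices `exp Φ`, `Φ = diag (φ, -φ)` with `φ` constant in `ζ`. -/
def ZeroGroup : Set Mat :=
  {A | ∃ φ : ℂ, A = !![cst (Complex.exp φ), 0; 0, cst (Complex.exp (-φ))]}

/-- Three matrices `g_{<0}`, `g_0`, `g_{>0}` depending on `(t, t̄)`, with a domain outside of which
their values are irrelevant. -/
structure Triple where
  dom : Set Times
  neg : Times → Mat
  zero : Times → Mat
  pos : Times → Mat

namespace Triple

/-- On the domain, the three matrices are the factors of a Gauss decomposition
`g_{<0}⁻¹ g_0 g_{>0}`. -/
def IsGauss (g : Triple) : Prop :=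
  ∀ x ∈ g.dom, g.neg x ∈ NegGroup ∧ g.zero x ∈ ZeroGroup ∧ g.pos x ∈ PosGroup

/-- The upper left entry of `W₁`, i.e. `W₁ = diag (q, r)`. -/
def q (g : Triple) (x : Times) : ℂ := negCoeff (g.neg x) 1 0

/-- The lower right entry of `W₁`. -/
def r (g : Triple) (x : Times) : ℂ := negCoeff (g.neg x) 1 1

/-- The upper left entry of `W̄₁`, i.e. `W̄₁ = diag (q̄, r̄)`. -/
def qbar (g : Triple) (x : Times) : ℂ := posCoeff (g.pos x) 1 0

/-- The lower right entry of `W̄₁`. -/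
def rbar (g : Triple) (x : Times) : ℂ := posCoeff (g.pos x) 1 1

/-- `e^φ`, where `g_0 = diag (e^φ, e^{-φ})`. -/
def ephi (g : Triple) (x : Times) : ℂ := (g.zero x 0 0).coeff 0

end Triple

/-! ### Similarity conditions -/

/-- `(t, t̄) ↦ (t_λ, t̄_{λ⁻¹})`, i.e. `tₙ ↦ λⁿ tₙ` and `t̄ₙ ↦ λ⁻ⁿ t̄ₙ`. -/
def scale (lam : ℂ) (x : Times) : Times :=
  (fun n => lam ^ (n : ℕ) * x.1 n, fun n => (lam⁻¹) ^ (n : ℕ) * x.2 n)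

/-- `λ^{a H₀} = diag (λ^a, λ^{-a})`, where `λ = e^l` and `λ^a := e^{a l}`. -/
def powH (l a : ℂ) : Mat :=
  !![cst (Complex.exp (a * l)), 0; 0, cst (Complex.exp (-(a * l)))]

/-- The similarity conditions `g_{<0}^λ = g_{<0}`, `g_0^λ = g_0`, `g_{>0}^λ = g_{>0}` with parameters
`α`, `β`. Since `λ^α` and the functions themselves are in general multivalued, we write `λ = e^l`
and impose the conditions at `(t, t̄)` for all `l` such that the path
`s ↦ (t_{λ^s}, t̄_{λ^{-s}})`, `0 ≤ s ≤ 1`, where `λ^s = e^{s l}`, stays in the domain.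
The matrix `g_{<0}` is expanded in `ζ⁻¹`, in which `ζ ↦ λ⁻¹ ζ` is `ζ⁻¹ ↦ λ ζ⁻¹`. -/
def Triple.IsSimilar (g : Triple) (α β : ℂ) : Prop :=
  ∀ (x : Times) (l : ℂ),
    (∀ s ∈ Set.Icc (0 : ℝ) 1, scale (Complex.exp (s * l)) x ∈ g.dom) →
    powH l α * (g.neg (scale (Complex.exp l) x)).map (rescale (Complex.exp l)) * powH l (-α)
        = g.neg x ∧
    powH l α * g.zero (scale (Complex.exp l) x) * powH l (-β) = g.zero x ∧
    powH l β * (g.pos (scale (Complex.exp l) x)).map (rescale (Complex.exp l)⁻¹) * powH l (-β)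
        = g.pos x

/-! ### The six basic transformations -/

/-- `(t, t̄) ↦ (-t, t̄)`. -/
def negT (x : Times) : Times := (-x.1, x.2)

/-- `(t, t̄) ↦ (t, -t̄)`. -/
def negTbar (x : Times) : Times := (x.1, -x.2)

def S0 (ζ : Ser) : Mat := !![0, ζ⁻¹; -ζ, 0]

def S1 : Mat := !![0, -1; 1, 0]

def GL0 (ζ : Ser) (q : ℂ) : Mat := !![cst (-1 / q), 0; ζ, cst (-q)]

def GL1 (r : ℂ) : Mat := !![cst (-r), 1; 0, cst (-1 / r)]

def GLbar0 (ζ : Ser) (q e : ℂ) : Mat := !![1, 0; -ζ * cst (e ^ 2 / q), 1]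

def GLbar1 (r e : ℂ) : Mat := !![1, cst (-1 / (r * e ^ 2)); 0, 1]

def GR0 (ζ : Ser) (rbar e : ℂ) : Mat := !![1, -ζ⁻¹ * cst (e ^ 2 / rbar); 0, 1]

def GR1 (qbar e : ℂ) : Mat := !![1, 0; cst (-1 / (qbar * e ^ 2)), 1]

def GRbar0 (ζ : Ser) (rbar : ℂ) : Mat := !![cst rbar, -ζ⁻¹; 0, cst (1 / rbar)]

def GRbar1 (qbar : ℂ) : Mat := !![cst (1 / qbar), 0; -1, cst qbar]

/-- `P` up to the scalar factor `ζ^{-1/2}`, which cancels in the conjugation by `P`. -/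
def P (ζ : Ser) : Mat := !![0, 1; -ζ, 0]

namespace Triple

/-- `σ`: exchanges `t` and `t̄`, `W_i` and `W̄_i`, and replaces `Φ` by `-Φ`. -/
def sigma (g : Triple) : Triple where
  dom := {x | x.swap ∈ g.dom}
  neg x := ofNegCoeff (posCoeff (g.pos x.swap))
  zero x := (g.zero x.swap)⁻¹
  pos x := ofPosCoeff (negCoeff (g.neg x.swap))

/-- `s_0^L`, defined where `q ≠ 0`. -/
def sL0 (g : Triple) : Triple where
  dom := {x | negT x ∈ g.dom ∧ g.q (negT x) ≠ 0}
  neg x := GL0 zetaNeg (g.q (negT x)) * g.neg (negT x) * S0 zetaNeg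
  zero x := GL0 zetaPos (g.q (negT x)) * g.zero (negT x) *
    (GLbar0 zetaPos (g.q (negT x)) (g.ephi (negT x)))⁻¹
  pos x := GLbar0 zetaPos (g.q (negT x)) (g.ephi (negT x)) * g.pos (negT x)

/-- `s_1^L`, defined where `r ≠ 0`. -/
def sL1 (g : Triple) : Triple where
  dom := {x | negT x ∈ g.dom ∧ g.r (negT x) ≠ 0}
  neg x := GL1 (g.r (negT x)) * g.neg (negT x) * S1
  zero x := GL1 (g.r (negT x)) * g.zero (negT x) *
    (GLbar1 (g.r (negT x)) (g.ephi (negT x)))⁻¹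
  pos x := GLbar1 (g.r (negT x)) (g.ephi (negT x)) * g.pos (negT x)

/-- `s_0^R`, defined where `r̄ ≠ 0`. -/
def sR0 (g : Triple) : Triple where
  dom := {x | negTbar x ∈ g.dom ∧ g.rbar (negTbar x) ≠ 0}
  neg x := GR0 zetaNeg (g.rbar (negTbar x)) (g.ephi (negTbar x)) * g.neg (negTbar x)
  zero x := GR0 zetaPos (g.rbar (negTbar x)) (g.ephi (negTbar x)) * g.zero (negTbar x) *
    (GRbar0 zetaPos (g.rbar (negTbar x)))⁻¹
  pos x := GRbar0 zetaPos (g.rbar (negTbar x)) * g.pos (negTbar x) * S0 zetaPos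

/-- `s_1^R`, defined where `q̄ ≠ 0`. -/
def sR1 (g : Triple) : Triple where
  dom := {x | negTbar x ∈ g.dom ∧ g.qbar (negTbar x) ≠ 0}
  neg x := GR1 (g.qbar (negTbar x)) (g.ephi (negTbar x)) * g.neg (negTbar x)
  zero x := GR1 (g.qbar (negTbar x)) (g.ephi (negTbar x)) * g.zero (negTbar x) *
    (GRbar1 (g.qbar (negTbar x)))⁻¹
  pos x := GRbar1 (g.qbar (negTbar x)) * g.pos (negTbar x) * S1

/-- `π`: conjugation by `P` and `(t, t̄) ↦ (-t, -t̄)`. -/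
def dynkin (g : Triple) : Triple where
  dom := {x | -x ∈ g.dom}
  neg x := (P zetaNeg)⁻¹ * g.neg (-x) * P zetaNeg
  zero x := (P zetaPos)⁻¹ * g.zero (-x) * P zetaPos
  pos x := (P zetaPos)⁻¹ * g.pos (-x) * P zetaPos

end Triple

end

end MPLR

/-! Put `λ = e^l` and let `T_{a,b}` send `A` to `λ^{aH₀} A(λ⁻¹ζ) λ^{-bH₀}`. Similarity says that
`T_{α,α}`, `T_{α,β}`, `T_{β,β}` carry the three matrices at the scaled point to those at the
original point. The operators compose like arrows, `T_{a,c}(AB) = T_{a,b}(A) T_{b,c}(B)`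
(`twist_mul`), so a product of factors can be treated factor by factor.

An antidiagonal matrix reverses `H₀`: `S₁` is fixed by `T_{a,b}` when `a + b = 0`, `S₀` when `a + b
= -1`, and `P` when `a + b = -1/2`. This produces the new parameters. The factors `G_i`, `Ḡ_i`
depend on the point only through `e^φ` and one of `q`, `r`, `q̄`, `r̄`. Comparing coefficients in
the similarity conditions gives each of these a definite weight in `λ`, and with these weights the
twisted factor at the scaled point is the factor at the original point. The map `σ` inverts `λ` and
amounts to conjugation by `diag(X^{1/2}, X^{-1/2})` in the expansion variable `X`, whence its sign
and its shift by `1/2`.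

That the transforms again have the required form is a leading-term cancellation: `q`, `r`, `q̄`,
`r̄` are the coefficients that make the poles created by `G_i` and `S_i` vanish and the diagonal
start with `1`. The factor `Ḡ_i` is chosen so that `G_i e^Φ Ḡ_i⁻¹` is diagonal. -/

namespace MPLR

open Matrix

/-! ### Laurent series and the rescaling of the variable -/

section Series

theorem cst_ne_zero {a : ℂ} (ha : a ≠ 0) : cst a ≠ 0 := by
  simpa [cst] using ha

theorem zetaPos_ne_zero : zetaPos ≠ 0 := by
  simp [zetaPos]

/-- Both kinds of series share one type, so `zetaPos` serves below as the expansion variable `X` on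
either side: it stands for `ζ` in `g_{>0}` and for `ζ⁻¹` in `g_{<0}`. -/
theorem zetaNeg_eq_inv : zetaNeg = zetaPos⁻¹ := by
  simp [zetaNeg, zetaPos]

theorem coe_X_eq_zetaPos : ((PowerSeries.X : PowerSeries ℂ) : Ser) = zetaPos :=
  PowerSeries.coe_X

theorem coeff_zero_zetaPos_mul (f : PowerSeries ℂ) : (zetaPos * (f : Ser)).coeff 0 = 0 := by
  rw [← coe_X_eq_zetaPos, ← PowerSeries.coe_mul, PowerSeries.coeff_coe]
  simp

theorem coeff_one_zetaPos_mul (f : Ser) : (zetaPos * f).coeff 1 = f.coeff 0 := by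
  have := HahnSeries.coeff_single_mul_add (r := (1 : ℂ)) (x := f) (a := (0 : ℤ)) (b := 1)
  simpa [zetaPos] using this

theorem exists_eq_cst_add (f : PowerSeries ℂ) :
    ∃ g : PowerSeries ℂ, (f : Ser) = cst (PowerSeries.constantCoeff f) + zetaPos * (g : Ser) := by
  refine ⟨PowerSeries.mk fun p => PowerSeries.coeff (p + 1) f, ?_⟩
  conv_lhs => rw [PowerSeries.eq_X_mul_shift_add_const f]
  rw [PowerSeries.coe_add, PowerSeries.coe_mul, PowerSeries.coe_C, coe_X_eq_zetaPos, add_comm]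

/-- The substitution `X ↦ e^m X` as a ring endomorphism. -/
noncomputable def rescaleHom (m : ℂ) : Ser →+* Ser where
  toFun := rescale (Complex.exp m)
  map_one' := by
    ext n
    by_cases hn : n = 0 <;> simp [rescale, HahnSeries.coeff_one, hn]
  map_mul' f g := by
    ext n
    have hf : (rescale (Complex.exp m) f).support ⊆ f.support := fun i hi => by
      simp only [HahnSeries.mem_support, rescale] at hi ⊢
      exact right_ne_zero_of_mul hi
    have hg : (rescale (Complex.exp m) g).support ⊆ g.support := fun i hi => by
      simp only [HahnSeries.mem_support, rescale] at hi ⊢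
      exact right_ne_zero_of_mul hi
    -- The convolution may be summed over the supports of `f` and `g`, which contain those of the
    -- rescaled series; both sides then have the same index set.
    have key : (rescale (Complex.exp m) f * rescale (Complex.exp m) g).coeff n =
        ∑ ij ∈ Finset.antidiagonal f.isPWO_support g.isPWO_support n,
          (rescale (Complex.exp m) f).coeff ij.1 * (rescale (Complex.exp m) g).coeff ij.2 := by
      rw [HahnSeries.coeff_mul]
      refine Finset.sum_subset (fun ij h => ?_) (fun ij h h' => ?_)
      · simp only [Finset.mem_antidiagonal] at h ⊢
        exact ⟨hf h.1, hg h.2.1, h.2.2⟩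
      · simp only [Finset.mem_antidiagonal, HahnSeries.mem_support] at h h'
        by_contra hne
        exact h' ⟨left_ne_zero_of_mul hne, right_ne_zero_of_mul hne, h.2.2⟩
    rw [key]
    simp only [rescale]
    rw [HahnSeries.coeff_mul, Finset.mul_sum]
    refine Finset.sum_congr rfl fun ij h => ?_
    rw [← (Finset.mem_antidiagonal.1 h).2.2, zpow_add₀ (Complex.exp_ne_zero m)]
    ring
  map_zero' := by ext n; simp [rescale]
  map_add' f g := by ext n; simp [rescale, mul_add]

theorem rescale_eq_rescaleHom (m : ℂ) : rescale (Complex.exp m) = rescaleHom m := rfl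

theorem coeff_rescaleHom (m : ℂ) (f : Ser) (n : ℤ) :
    (rescaleHom m f).coeff n = Complex.exp m ^ n * f.coeff n := rfl

theorem rescaleHom_cst (m a : ℂ) : rescaleHom m (cst a) = cst a := by
  ext n
  by_cases hn : n = 0 <;> simp [coeff_rescaleHom, hn, HahnSeries.C_apply]

theorem rescaleHom_zetaPos (m : ℂ) :
    rescaleHom m zetaPos = cst (Complex.exp m) * zetaPos := by
  ext n
  by_cases hn : n = 1 <;>
    simp [coeff_rescaleHom, zetaPos, hn, HahnSeries.C_apply]

end Series

/-! ### Entrywise description of the three groups -/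

section Groups

/-- Even powers of `Λ` fill the diagonal and odd powers the antidiagonal, so the expansion in `Λ`
amounts to four independent power series; `W_0 = I` becomes constant term `1` on the diagonal. -/
theorem mk_mem_NegGroup {A : Mat} {a b c d : PowerSeries ℂ}
    (h00 : A 0 0 = 1 + zetaPos * (a : Ser)) (h01 : A 0 1 = zetaPos * (b : Ser))
    (h10 : A 1 0 = (c : Ser)) (h11 : A 1 1 = 1 + zetaPos * (d : Ser)) (hdet : A.det = 1) :
    A ∈ NegGroup := by
  refine ⟨⟨fun n => if Even n
    then ![PowerSeries.coeff (n / 2) (1 + PowerSeries.X * a),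
      PowerSeries.coeff (n / 2) (1 + PowerSeries.X * d)]
    else ![PowerSeries.coeff (n / 2) b, PowerSeries.coeff (n / 2) c], ?_, ?_⟩, hdet⟩
  · ext i
    fin_cases i <;> simp
  · have h2 (k : ℕ) : (2 * k + 1) / 2 = k := by omega
    have hmk (f : PowerSeries ℂ) : (PowerSeries.mk fun k => PowerSeries.coeff k f) = f := by
      ext; simp
    rw [Matrix.eta_fin_two A, h00, h01, h10, h11]
    simp [ofNegCoeff, h2, hmk, zetaNeg_eq_inv, -map_add, PowerSeries.coe_add, PowerSeries.coe_mul,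
      zetaPos]

theorem mk_mem_PosGroup {A : Mat} {a b c d : PowerSeries ℂ}
    (h00 : A 0 0 = 1 + zetaPos * (a : Ser)) (h01 : A 0 1 = (b : Ser))
    (h10 : A 1 0 = zetaPos * (c : Ser)) (h11 : A 1 1 = 1 + zetaPos * (d : Ser))
    (hdet : A.det = 1) :
    A ∈ PosGroup := by
  refine ⟨⟨fun n => if Even n
    then ![PowerSeries.coeff (n / 2) (1 + PowerSeries.X * a),
      PowerSeries.coeff (n / 2) (1 + PowerSeries.X * d)]
    else ![PowerSeries.coeff (n / 2) b, PowerSeries.coeff (n / 2) c], ?_, ?_⟩, hdet⟩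
  · ext i
    fin_cases i <;> simp
  · have h2 (k : ℕ) : (2 * k + 1) / 2 = k := by omega
    have hmk (f : PowerSeries ℂ) : (PowerSeries.mk fun k => PowerSeries.coeff k f) = f := by
      ext; simp
    rw [Matrix.eta_fin_two A, h00, h01, h10, h11]
    simp [ofPosCoeff, h2, hmk, -map_add, PowerSeries.coe_add, PowerSeries.coe_mul,
      zetaPos]

theorem negCoeff_one_zero (A : Mat) : negCoeff A 1 0 = (A 0 1).coeff 1 := by
  simp [negCoeff]

theorem negCoeff_one_one (A : Mat) : negCoeff A 1 1 = (A 1 0).coeff 0 := by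
  simp [negCoeff]

theorem posCoeff_one_zero (A : Mat) : posCoeff A 1 0 = (A 0 1).coeff 0 := by
  simp [posCoeff]

theorem posCoeff_one_one (A : Mat) : posCoeff A 1 1 = (A 1 0).coeff 1 := by
  simp [posCoeff]

/-- Isolating `q` and `r` as leading terms is what makes the later pole cancellations visible. -/
theorem exists_of_mem_NegGroup {A : Mat} (hA : A ∈ NegGroup) :
    ∃ a b c d : PowerSeries ℂ,
      A = !![1 + zetaPos * (a : Ser), zetaPos * (cst (negCoeff A 1 0) + zetaPos * (b : Ser));
        cst (negCoeff A 1 1) + zetaPos * (c : Ser), 1 + zetaPos * (d : Ser)] := by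
  obtain ⟨⟨W, hW, rfl⟩, -⟩ := hA
  rw [negCoeff_one_zero, negCoeff_one_one, ofNegCoeff, zetaNeg_eq_inv, inv_inv]
  obtain ⟨a, ha⟩ := exists_eq_cst_add (PowerSeries.mk fun k => W (2 * k) 0)
  obtain ⟨b, hb⟩ := exists_eq_cst_add (PowerSeries.mk fun k => W (2 * k + 1) 0)
  obtain ⟨c, hc⟩ := exists_eq_cst_add (PowerSeries.mk fun k => W (2 * k + 1) 1)
  obtain ⟨d, hd⟩ := exists_eq_cst_add (PowerSeries.mk fun k => W (2 * k) 1)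
  refine ⟨a, b, c, d, ?_⟩
  rw [ha, hb, hc, hd]
  simp [coeff_zero_zetaPos_mul, coeff_one_zetaPos_mul, ← PowerSeries.coeff_zero_eq_constantCoeff_apply,
    hW, -PowerSeries.coeff_zero_eq_constantCoeff]

theorem exists_of_mem_PosGroup {A : Mat} (hA : A ∈ PosGroup) :
    ∃ a b c d : PowerSeries ℂ,
      A = !![1 + zetaPos * (a : Ser), cst (posCoeff A 1 0) + zetaPos * (b : Ser);
        zetaPos * (cst (posCoeff A 1 1) + zetaPos * (c : Ser)), 1 + zetaPos * (d : Ser)] := by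
  obtain ⟨⟨W, hW, rfl⟩, -⟩ := hA
  rw [posCoeff_one_zero, posCoeff_one_one, ofPosCoeff]
  obtain ⟨a, ha⟩ := exists_eq_cst_add (PowerSeries.mk fun k => W (2 * k) 0)
  obtain ⟨b, hb⟩ := exists_eq_cst_add (PowerSeries.mk fun k => W (2 * k + 1) 0)
  obtain ⟨c, hc⟩ := exists_eq_cst_add (PowerSeries.mk fun k => W (2 * k + 1) 1)
  obtain ⟨d, hd⟩ := exists_eq_cst_add (PowerSeries.mk fun k => W (2 * k) 1)
  refine ⟨a, b, c, d, ?_⟩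
  rw [ha, hb, hc, hd]
  simp [coeff_zero_zetaPos_mul, coeff_one_zetaPos_mul, ← PowerSeries.coeff_zero_eq_constantCoeff_apply,
    hW, -PowerSeries.coeff_zero_eq_constantCoeff]

/-- `diag (z, z⁻¹)`. -/
noncomputable def torus (z : ℂ) : Mat := !![cst z, 0; 0, cst z⁻¹]

theorem torus_mem_ZeroGroup {z : ℂ} (hz : z ≠ 0) : torus z ∈ ZeroGroup :=
  -- Any branch of `φ` will do, since only `e^φ` enters the formulas.
  ⟨Complex.log z, by rw [Complex.exp_neg, Complex.exp_log hz, torus]⟩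

theorem exists_of_mem_ZeroGroup {A : Mat} (hA : A ∈ ZeroGroup) :
    (A 0 0).coeff 0 ≠ 0 ∧ A = torus ((A 0 0).coeff 0) := by
  obtain ⟨φ, rfl⟩ := hA
  simp [torus, Complex.exp_neg, HahnSeries.C_apply]

theorem torus_mul (z w : ℂ) : torus z * torus w = torus (z * w) := by
  simp [torus, mul_comm]

theorem torus_inv {z : ℂ} (hz : z ≠ 0) : (torus z)⁻¹ = torus z⁻¹ := by
  apply Matrix.inv_eq_right_inv
  rw [torus_mul, mul_inv_cancel₀ hz]
  simp [torus, Matrix.one_fin_two]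

theorem powH_eq_torus (l a : ℂ) : powH l a = torus (Complex.exp (a * l)) := by
  rw [powH, torus, Complex.exp_neg]

theorem powH_neg_eq_torus (l a : ℂ) : powH l (-a) = torus (Complex.exp (a * l))⁻¹ := by
  rw [powH_eq_torus, neg_mul, Complex.exp_neg]

theorem powH_mul_torus_mul_powH (l a b z : ℂ) :
    powH l a * torus z * powH l (-b) =
      torus (Complex.exp (a * l) * z * (Complex.exp (b * l))⁻¹) := by
  rw [powH_eq_torus, powH_neg_eq_torus, torus_mul, torus_mul]

end Groups

/-! ### The twist operator -/

section Twist

/-- `λ^{a H₀} A(e^m X) λ^{-b H₀}`, where `λ = e^l`. -/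
noncomputable def twist (l m a b : ℂ) (A : Mat) : Mat :=
  powH l a * A.map (rescaleHom m) * powH l (-b)

theorem twist_mul (l m a b c : ℂ) (A B : Mat) :
    twist l m a c (A * B) = twist l m a b A * twist l m b c B := by
  have hinv : powH l (-b) * powH l b = 1 := by
    rw [powH_neg_eq_torus, powH_eq_torus, torus_mul, inv_mul_cancel₀ (Complex.exp_ne_zero _)]
    simp [torus, Matrix.one_fin_two]
  simp only [twist, Matrix.map_mul]
  -- The middle parameter `b` is free: `1 = λ^{-bH₀} λ^{bH₀}` is inserted between the factors.
  calc _ = powH l a * A.map (rescaleHom m) * 1 * B.map (rescaleHom m) * powH l (-c) := by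
        simp only [Matrix.mul_assoc, Matrix.one_mul]
    _ = _ := by rw [← hinv]; simp only [Matrix.mul_assoc]

theorem twist_eq (l m a b : ℂ) (A : Mat) :
    twist l m a b A =
      !![cst (Complex.exp (a * l) * (Complex.exp (b * l))⁻¹) * rescaleHom m (A 0 0),
        cst (Complex.exp (a * l) * Complex.exp (b * l)) * rescaleHom m (A 0 1);
        cst ((Complex.exp (a * l))⁻¹ * (Complex.exp (b * l))⁻¹) * rescaleHom m (A 1 0),
        cst ((Complex.exp (a * l))⁻¹ * Complex.exp (b * l)) * rescaleHom m (A 1 1)] := by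
  rw [twist, powH_eq_torus, powH_neg_eq_torus, Matrix.eta_fin_two (A.map _), torus, torus,
    Matrix.mul_fin_two, Matrix.mul_fin_two]
  simp only [Matrix.map_apply, cst, map_mul, inv_inv, mul_zero, zero_mul, add_zero, zero_add]
  congr! 3 <;> ring_nf

end Twist

/-! ### Twists of the elementary factors and the diagonal part -/

section Factors

theorem exp_neg_sub_one_mul (a l : ℂ) :
    Complex.exp ((-a - 1) * l) = (Complex.exp (a * l))⁻¹ * (Complex.exp l)⁻¹ := by
  rw [← Complex.exp_neg, ← Complex.exp_neg, ← Complex.exp_add]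
  ring_nf

theorem exp_neg_mul (a l : ℂ) : Complex.exp (-a * l) = (Complex.exp (a * l))⁻¹ := by
  rw [← Complex.exp_neg, neg_mul]

theorem C_exp_ne_zero (a : ℂ) : (HahnSeries.C (Complex.exp a) : Ser) ≠ 0 :=
  cst_ne_zero (Complex.exp_ne_zero a)

variable {l α β q e : ℂ}

/-- The upper right entry acquires `λ^{a+b}` from the two diagonal factors and `λ` from `ζ⁻¹`, which
forces `a + b = -1`. -/
theorem twist_S0_zetaNeg : twist l l α (-α - 1) (S0 zetaNeg) = S0 zetaNeg := by
  have h1 := C_exp_ne_zero l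
  have h2 := C_exp_ne_zero (α * l)
  have h3 := zetaPos_ne_zero
  rw [twist_eq, exp_neg_sub_one_mul, S0, zetaNeg_eq_inv]
  simp [rescaleHom_zetaPos, -HahnSeries.C_apply, cst]
  field_simp

theorem twist_S0_zetaPos : twist l (-l) α (-α - 1) (S0 zetaPos) = S0 zetaPos := by
  have h1 := C_exp_ne_zero l
  have h2 := C_exp_ne_zero (α * l)
  have h3 := zetaPos_ne_zero
  rw [twist_eq, exp_neg_sub_one_mul, S0]
  simp [rescaleHom_zetaPos, -HahnSeries.C_apply, cst, Complex.exp_neg]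
  constructor <;> field_simp

theorem twist_S1 (m : ℂ) : twist l m α (-α) S1 = S1 := by
  have h2 := C_exp_ne_zero (α * l)
  rw [twist_eq, exp_neg_mul, S1]
  simp [-HahnSeries.C_apply, cst]

/-- The argument on the right is the value at the original point when `q` is the value at the scaled
point, by `negCoeff_one_zero_of_twist`. The companion lemmas follow the same pattern. -/
theorem twist_GL0 (hq : q ≠ 0) :
    twist l l (-α - 1) α (GL0 zetaNeg q) =
      GL0 zetaNeg (Complex.exp (α * l) ^ 2 * Complex.exp l * q) := by
  have h1 := C_exp_ne_zero l
  have h2 := C_exp_ne_zero (α * l)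
  have h3 : (HahnSeries.C q : Ser) ≠ 0 := cst_ne_zero hq
  have h4 := zetaPos_ne_zero
  rw [twist_eq, exp_neg_sub_one_mul, GL0, zetaNeg_eq_inv]
  simp [rescaleHom_cst, rescaleHom_zetaPos, -HahnSeries.C_apply, cst, GL0]
  repeat' apply And.intro
  all_goals field_simp

theorem twist_GL1 (hq : q ≠ 0) :
    twist l l (-α) α (GL1 q) = GL1 ((Complex.exp (α * l))⁻¹ ^ 2 * q) := by
  have h2 := C_exp_ne_zero (α * l)
  have h3 : (HahnSeries.C q : Ser) ≠ 0 := cst_ne_zero hq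
  rw [twist_eq, exp_neg_mul, GL1]
  simp [rescaleHom_cst, -HahnSeries.C_apply, cst, GL1]
  repeat' apply And.intro
  all_goals field_simp

/-- The weights `λ^{2α-2β}` of `e²` and `λ^{2α+1}` of `q` have quotient `λ^{-2β-1}`. So `α` cancels,
leaving what conjugation by `λ^{βH₀}` and `ζ ↦ λ⁻¹ζ` produce. -/
theorem twist_GLbar0 (hq : q ≠ 0) :
    twist l (-l) β β (GLbar0 zetaPos q e) =
      GLbar0 zetaPos (Complex.exp (α * l) ^ 2 * Complex.exp l * q)
        (Complex.exp (α * l) * e * (Complex.exp (β * l))⁻¹) := by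
  have h1 := C_exp_ne_zero l
  have h2 := C_exp_ne_zero (α * l)
  have h2' := C_exp_ne_zero (β * l)
  have h3 : (HahnSeries.C q : Ser) ≠ 0 := cst_ne_zero hq
  have h4 := zetaPos_ne_zero
  rw [twist_eq, GLbar0]
  simp [rescaleHom_cst, rescaleHom_zetaPos, -HahnSeries.C_apply, cst, GLbar0, Complex.exp_neg]
  field_simp

theorem twist_GLbar1 (hq : q ≠ 0) (he : e ≠ 0) :
    twist l (-l) β β (GLbar1 q e) =
      GLbar1 ((Complex.exp (α * l))⁻¹ ^ 2 * q)
        (Complex.exp (α * l) * e * (Complex.exp (β * l))⁻¹) := by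
  have h2 := C_exp_ne_zero (α * l)
  have h2' := C_exp_ne_zero (β * l)
  have h3 : (HahnSeries.C q : Ser) ≠ 0 := cst_ne_zero hq
  have h3' : (HahnSeries.C e : Ser) ≠ 0 := cst_ne_zero he
  rw [twist_eq, GLbar1]
  simp [rescaleHom_cst, -HahnSeries.C_apply, cst, GLbar1]
  field_simp

theorem twist_GR0 (hq : q ≠ 0) :
    twist l l α α (GR0 zetaNeg q e) =
      GR0 zetaNeg ((Complex.exp (β * l))⁻¹ ^ 2 * (Complex.exp l)⁻¹ * q)
        (Complex.exp (α * l) * e * (Complex.exp (β * l))⁻¹) := by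
  have h1 := C_exp_ne_zero l
  have h2 := C_exp_ne_zero (α * l)
  have h2' := C_exp_ne_zero (β * l)
  have h3 : (HahnSeries.C q : Ser) ≠ 0 := cst_ne_zero hq
  have h4 := zetaPos_ne_zero
  rw [twist_eq, GR0, zetaNeg_eq_inv]
  simp [rescaleHom_cst, rescaleHom_zetaPos, -HahnSeries.C_apply, cst, GR0]
  field_simp

theorem twist_GR1 (hq : q ≠ 0) (he : e ≠ 0) :
    twist l l α α (GR1 q e) =
      GR1 (Complex.exp (β * l) ^ 2 * q)
        (Complex.exp (α * l) * e * (Complex.exp (β * l))⁻¹) := by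
  have h2 := C_exp_ne_zero (α * l)
  have h2' := C_exp_ne_zero (β * l)
  have h3 : (HahnSeries.C q : Ser) ≠ 0 := cst_ne_zero hq
  have h3' : (HahnSeries.C e : Ser) ≠ 0 := cst_ne_zero he
  rw [twist_eq, GR1]
  simp [rescaleHom_cst, -HahnSeries.C_apply, cst, GR1]
  field_simp

theorem twist_GRbar0 (hq : q ≠ 0) :
    twist l (-l) (-β - 1) β (GRbar0 zetaPos q) =
      GRbar0 zetaPos ((Complex.exp (β * l))⁻¹ ^ 2 * (Complex.exp l)⁻¹ * q) := by
  have h1 := C_exp_ne_zero l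
  have h2 := C_exp_ne_zero (β * l)
  have h3 : (HahnSeries.C q : Ser) ≠ 0 := cst_ne_zero hq
  have h4 := zetaPos_ne_zero
  rw [twist_eq, exp_neg_sub_one_mul, GRbar0]
  simp [rescaleHom_cst, rescaleHom_zetaPos, -HahnSeries.C_apply, -mul_eq_mul_left_iff, -mul_eq_mul_right_iff, cst, GRbar0, Complex.exp_neg]
  repeat' apply And.intro
  all_goals field_simp

theorem twist_GRbar1 (hq : q ≠ 0) :
    twist l (-l) (-β) β (GRbar1 q) = GRbar1 (Complex.exp (β * l) ^ 2 * q) := by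
  have h2 := C_exp_ne_zero (β * l)
  have h3 : (HahnSeries.C q : Ser) ≠ 0 := cst_ne_zero hq
  rw [twist_eq, exp_neg_mul, GRbar1]
  simp [rescaleHom_cst, -HahnSeries.C_apply, -mul_eq_mul_left_iff, -mul_eq_mul_right_iff, cst, GRbar1]
  repeat' apply And.intro
  all_goals field_simp

/-- Replaces the computation of `Ḡ_i⁻¹` by the product identity `G_i e^Φ = C Ḡ_i`. -/
theorem mul_inv_eq_of_eq_mul {A B C : Mat} (hB : B.det = 1) (h : A = C * B) : A * B⁻¹ = C := by
  rw [h, Matrix.mul_nonsing_inv_cancel_right _ _ (by rw [hB]; exact isUnit_one)]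

theorem GL0_mul_torus_mul_inv (hq : q ≠ 0) (he : e ≠ 0) :
    GL0 zetaPos q * torus e * (GLbar0 zetaPos q e)⁻¹ = torus (-e / q) := by
  have h3 : (HahnSeries.C q : Ser) ≠ 0 := cst_ne_zero hq
  have h3' : (HahnSeries.C e : Ser) ≠ 0 := cst_ne_zero he
  apply mul_inv_eq_of_eq_mul
  · simp [GLbar0, Matrix.det_fin_two]
  · simp [GL0, GLbar0, torus, -HahnSeries.C_apply, cst]
    repeat' apply And.intro
    all_goals field_simp

theorem GL1_mul_torus_mul_inv (hq : q ≠ 0) (he : e ≠ 0) :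
    GL1 q * torus e * (GLbar1 q e)⁻¹ = torus (-(q * e)) := by
  have h3 : (HahnSeries.C q : Ser) ≠ 0 := cst_ne_zero hq
  have h3' : (HahnSeries.C e : Ser) ≠ 0 := cst_ne_zero he
  apply mul_inv_eq_of_eq_mul
  · simp [GLbar1, Matrix.det_fin_two]
  · simp [GL1, GLbar1, torus, -HahnSeries.C_apply, cst]
    repeat' apply And.intro
    all_goals field_simp

theorem GR0_mul_torus_mul_inv (hq : q ≠ 0) (he : e ≠ 0) :
    GR0 zetaPos q e * torus e * (GRbar0 zetaPos q)⁻¹ = torus (e / q) := by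
  have h3 : (HahnSeries.C q : Ser) ≠ 0 := cst_ne_zero hq
  have h3' : (HahnSeries.C e : Ser) ≠ 0 := cst_ne_zero he
  have h4 := zetaPos_ne_zero
  apply mul_inv_eq_of_eq_mul
  · simp [GRbar0, Matrix.det_fin_two, -HahnSeries.C_apply, cst]
    field_simp
  · simp [GR0, GRbar0, torus, -HahnSeries.C_apply, cst]
    repeat' apply And.intro
    all_goals field_simp

theorem GR1_mul_torus_mul_inv (hq : q ≠ 0) (he : e ≠ 0) :
    GR1 q e * torus e * (GRbar1 q)⁻¹ = torus (q * e) := by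
  have h3 : (HahnSeries.C q : Ser) ≠ 0 := cst_ne_zero hq
  have h3' : (HahnSeries.C e : Ser) ≠ 0 := cst_ne_zero he
  apply mul_inv_eq_of_eq_mul
  · simp [GRbar1, Matrix.det_fin_two, -HahnSeries.C_apply, cst]
    field_simp
  · simp [GR1, GRbar1, torus, -HahnSeries.C_apply, cst]
    repeat' apply And.intro
    all_goals field_simp

end Factors

/-! ### The transformed matrices stay in their groups -/

section Membership

variable {A : Mat}

theorem GL0_mul_mul_S0_mem (hA : A ∈ NegGroup) (hq : negCoeff A 1 0 ≠ 0) :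
    GL0 zetaNeg (negCoeff A 1 0) * A * S0 zetaNeg ∈ NegGroup := by
  have hdet := hA.2
  obtain ⟨a, b, c, d, h⟩ := exists_of_mem_NegGroup hA
  generalize negCoeff A 1 0 = q at *
  generalize negCoeff A 1 1 = r at *
  have h3 : (HahnSeries.C q : Ser) ≠ 0 := cst_ne_zero hq
  have h4 := zetaPos_ne_zero
  have hS : (S0 zetaNeg).det = 1 := by
    rw [zetaNeg_eq_inv]; simp [S0, Matrix.det_fin_two]; field_simp
  have hG : (GL0 zetaNeg q).det = 1 := by
    simp [GL0, Matrix.det_fin_two, -HahnSeries.C_apply, cst]; field_simp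
  -- The witnesses are read off from the product, with `X = ζ⁻¹`. Its lower left entry is `-X⁻¹(X⁻¹
  -- A₀₁ - q A₁₁)`; both terms in the bracket start with `q`, so the pole cancels and `q d - b`
  -- remains. The factor `1/q` turns the leading term of the upper left entry into `1`.
  refine mk_mem_NegGroup (a := PowerSeries.C (1 / q) * b)
    (b := -(PowerSeries.C (1 / q)) * (1 + PowerSeries.X * a))
    (c := PowerSeries.C q * d - b)
    (d := a - PowerSeries.C q * (PowerSeries.C r + PowerSeries.X * c)) ?_ ?_ ?_ ?_
    (by rw [Matrix.det_mul, Matrix.det_mul, hdet, hS, hG]; simp) <;>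
  · try simp only [PowerSeries.coe_add, PowerSeries.coe_sub, PowerSeries.coe_mul, PowerSeries.coe_C,
      PowerSeries.coe_neg, PowerSeries.coe_one, coe_X_eq_zetaPos]
    rw [h, zetaNeg_eq_inv]
    simp [GL0, S0, -HahnSeries.C_apply, cst]
    field_simp
    try ring

theorem GL1_mul_mul_S1_mem (hA : A ∈ NegGroup) (hr : negCoeff A 1 1 ≠ 0) :
    GL1 (negCoeff A 1 1) * A * S1 ∈ NegGroup := by
  have hdet := hA.2
  obtain ⟨a, b, c, d, h⟩ := exists_of_mem_NegGroup hA
  generalize negCoeff A 1 0 = q at *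
  generalize negCoeff A 1 1 = r at *
  have h3 : (HahnSeries.C r : Ser) ≠ 0 := cst_ne_zero hr
  have hS : S1.det = 1 := by simp [S1, Matrix.det_fin_two]
  have hG : (GL1 r).det = 1 := by
    simp [GL1, Matrix.det_fin_two, -HahnSeries.C_apply, cst]; field_simp
  refine mk_mem_NegGroup (a := d - PowerSeries.C r * (PowerSeries.C q + PowerSeries.X * b))
    (b := PowerSeries.C r * a - c)
    (c := -(PowerSeries.C (1 / r)) * (1 + PowerSeries.X * d))
    (d := PowerSeries.C (1 / r) * c) ?_ ?_ ?_ ?_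
    (by rw [Matrix.det_mul, Matrix.det_mul, hdet, hS, hG]; simp) <;>
  · try simp only [PowerSeries.coe_add, PowerSeries.coe_sub, PowerSeries.coe_mul, PowerSeries.coe_C,
      PowerSeries.coe_neg, PowerSeries.coe_one, coe_X_eq_zetaPos]
    rw [h]
    simp [GL1, S1, -HahnSeries.C_apply, cst]
    field_simp
    try ring

theorem GRbar0_mul_mul_S0_mem (hA : A ∈ PosGroup) (hr : posCoeff A 1 1 ≠ 0) :
    GRbar0 zetaPos (posCoeff A 1 1) * A * S0 zetaPos ∈ PosGroup := by
  have hdet := hA.2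
  obtain ⟨a, b, c, d, h⟩ := exists_of_mem_PosGroup hA
  generalize posCoeff A 1 0 = q at *
  generalize posCoeff A 1 1 = r at *
  have h3 : (HahnSeries.C r : Ser) ≠ 0 := cst_ne_zero hr
  have h4 := zetaPos_ne_zero
  have hS : (S0 zetaPos).det = 1 := by simp [S0, Matrix.det_fin_two]; field_simp
  have hG : (GRbar0 zetaPos r).det = 1 := by
    simp [GRbar0, Matrix.det_fin_two, -HahnSeries.C_apply, cst]; field_simp
  refine mk_mem_PosGroup (a := d - PowerSeries.C r * (PowerSeries.C q + PowerSeries.X * b))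
    (b := PowerSeries.C r * a - c)
    (c := -(PowerSeries.C (1 / r)) * (1 + PowerSeries.X * d))
    (d := PowerSeries.C (1 / r) * c) ?_ ?_ ?_ ?_
    (by rw [Matrix.det_mul, Matrix.det_mul, hdet, hS, hG]; simp) <;>
  · try simp only [PowerSeries.coe_add, PowerSeries.coe_sub, PowerSeries.coe_mul, PowerSeries.coe_C,
      PowerSeries.coe_neg, PowerSeries.coe_one, coe_X_eq_zetaPos]
    rw [h]
    simp [GRbar0, S0, -HahnSeries.C_apply, cst]
    field_simp
    try ring

theorem GRbar1_mul_mul_S1_mem (hA : A ∈ PosGroup) (hq : posCoeff A 1 0 ≠ 0) :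
    GRbar1 (posCoeff A 1 0) * A * S1 ∈ PosGroup := by
  have hdet := hA.2
  obtain ⟨a, b, c, d, h⟩ := exists_of_mem_PosGroup hA
  generalize posCoeff A 1 0 = q at *
  generalize posCoeff A 1 1 = r at *
  have h3 : (HahnSeries.C q : Ser) ≠ 0 := cst_ne_zero hq
  have hS : S1.det = 1 := by simp [S1, Matrix.det_fin_two]
  have hG : (GRbar1 q).det = 1 := by
    simp [GRbar1, Matrix.det_fin_two, -HahnSeries.C_apply, cst]; field_simp
  refine mk_mem_PosGroup (a := PowerSeries.C (1 / q) * b)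
    (b := -(PowerSeries.C (1 / q)) * (1 + PowerSeries.X * a))
    (c := PowerSeries.C q * d - b)
    (d := a - PowerSeries.C q * (PowerSeries.C r + PowerSeries.X * c)) ?_ ?_ ?_ ?_
    (by rw [Matrix.det_mul, Matrix.det_mul, hdet, hS, hG]; simp) <;>
  · try simp only [PowerSeries.coe_add, PowerSeries.coe_sub, PowerSeries.coe_mul, PowerSeries.coe_C,
      PowerSeries.coe_neg, PowerSeries.coe_one, coe_X_eq_zetaPos]
    rw [h]
    simp [GRbar1, S1, -HahnSeries.C_apply, cst]
    field_simp
    try ring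

/-- `Ḡ₀` is itself unipotent of positive type, so no cancellation is needed and the constants are
arbitrary. -/
theorem GLbar0_mul_mem (hA : A ∈ PosGroup) (q e : ℂ) : GLbar0 zetaPos q e * A ∈ PosGroup := by
  have hdet := hA.2
  obtain ⟨a, b, c, d, h⟩ := exists_of_mem_PosGroup hA
  generalize posCoeff A 1 0 = u at h
  generalize posCoeff A 1 1 = v at h
  have hG : (GLbar0 zetaPos q e).det = 1 := by simp [GLbar0, Matrix.det_fin_two]
  refine mk_mem_PosGroup (a := a)
    (b := PowerSeries.C u + PowerSeries.X * b)
    (c := PowerSeries.C v + PowerSeries.X * c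
      - PowerSeries.C (e ^ 2 / q) * (1 + PowerSeries.X * a))
    (d := d - PowerSeries.C (e ^ 2 / q) * (PowerSeries.C u + PowerSeries.X * b))
    ?_ ?_ ?_ ?_ (by rw [Matrix.det_mul, hdet, hG]; simp) <;>
  · try simp only [PowerSeries.coe_add, PowerSeries.coe_sub, PowerSeries.coe_mul, PowerSeries.coe_C,
      PowerSeries.coe_one, coe_X_eq_zetaPos]
    rw [h]
    simp [GLbar0, -HahnSeries.C_apply, cst]
    try ring

theorem GLbar1_mul_mem (hA : A ∈ PosGroup) (q e : ℂ) : GLbar1 q e * A ∈ PosGroup := by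
  have hdet := hA.2
  obtain ⟨a, b, c, d, h⟩ := exists_of_mem_PosGroup hA
  generalize posCoeff A 1 0 = u at h
  generalize posCoeff A 1 1 = v at h
  have hG : (GLbar1 q e).det = 1 := by simp [GLbar1, Matrix.det_fin_two]
  refine mk_mem_PosGroup
    (a := a + PowerSeries.C (-1 / (q * e ^ 2)) *
      (PowerSeries.C v + PowerSeries.X * c))
    (b := PowerSeries.C u + PowerSeries.X * b
      + PowerSeries.C (-1 / (q * e ^ 2)) * (1 + PowerSeries.X * d))
    (c := PowerSeries.C v + PowerSeries.X * c)
    (d := d)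
    ?_ ?_ ?_ ?_ (by rw [Matrix.det_mul, hdet, hG]; simp) <;>
  · try simp only [PowerSeries.coe_add, PowerSeries.coe_mul, PowerSeries.coe_C,
      PowerSeries.coe_one, coe_X_eq_zetaPos]
    rw [h]
    simp [GLbar1, -HahnSeries.C_apply, cst]
    try ring

theorem GR0_mul_mem (hA : A ∈ NegGroup) (q e : ℂ) : GR0 zetaNeg q e * A ∈ NegGroup := by
  have hdet := hA.2
  obtain ⟨a, b, c, d, h⟩ := exists_of_mem_NegGroup hA
  generalize negCoeff A 1 0 = u at h
  generalize negCoeff A 1 1 = v at h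
  have hG : (GR0 zetaNeg q e).det = 1 := by simp [GR0, Matrix.det_fin_two]
  refine mk_mem_NegGroup
    (a := a - PowerSeries.C (e ^ 2 / q) *
      (PowerSeries.C v + PowerSeries.X * c))
    (b := PowerSeries.C u + PowerSeries.X * b
      - PowerSeries.C (e ^ 2 / q) * (1 + PowerSeries.X * d))
    (c := PowerSeries.C v + PowerSeries.X * c)
    (d := d)
    ?_ ?_ ?_ ?_ (by rw [Matrix.det_mul, hdet, hG]; simp) <;>
  · try simp only [PowerSeries.coe_add, PowerSeries.coe_sub, PowerSeries.coe_mul, PowerSeries.coe_C,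
      PowerSeries.coe_one, coe_X_eq_zetaPos]
    rw [h, zetaNeg_eq_inv]
    simp [GR0, -HahnSeries.C_apply, cst]
    try ring

theorem GR1_mul_mem (hA : A ∈ NegGroup) (q e : ℂ) : GR1 q e * A ∈ NegGroup := by
  have hdet := hA.2
  obtain ⟨a, b, c, d, h⟩ := exists_of_mem_NegGroup hA
  generalize negCoeff A 1 0 = u at h
  generalize negCoeff A 1 1 = v at h
  have hG : (GR1 q e).det = 1 := by simp [GR1, Matrix.det_fin_two]
  refine mk_mem_NegGroup (a := a)
    (b := PowerSeries.C u + PowerSeries.X * b)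
    (c := PowerSeries.C v + PowerSeries.X * c
      + PowerSeries.C (-1 / (q * e ^ 2)) * (1 + PowerSeries.X * a))
    (d := d + PowerSeries.C (-1 / (q * e ^ 2)) *
      (PowerSeries.C u + PowerSeries.X * b))
    ?_ ?_ ?_ ?_ (by rw [Matrix.det_mul, hdet, hG]; simp) <;>
  · try simp only [PowerSeries.coe_add, PowerSeries.coe_mul, PowerSeries.coe_C,
      PowerSeries.coe_one, coe_X_eq_zetaPos]
    rw [h]
    simp [GR1, -HahnSeries.C_apply, cst]
    try ring

/-- The half-integral powers of `ζ` in `P` are absent from the conjugate, so `π` can be treated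
entrywise within Laurent series. -/
theorem P_inv_mul_mul_P {z : Ser} (hz : z ≠ 0) (A : Mat) :
    (P z)⁻¹ * A * P z = !![A 1 1, -z⁻¹ * A 1 0; -z * A 0 1, A 0 0] := by
  have hinv : (P z)⁻¹ = !![0, -z⁻¹; 1, 0] := by
    apply Matrix.inv_eq_right_inv
    simp [P, Matrix.one_fin_two]
    field_simp
  rw [hinv]
  conv_lhs => rw [Matrix.eta_fin_two A]
  simp [P]
  constructor
  · field_simp
  · ring

theorem P_inv_mul_mul_P_mem_NegGroup (hA : A ∈ NegGroup) :
    (P zetaNeg)⁻¹ * A * P zetaNeg ∈ NegGroup := by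
  have hdet := hA.2
  have h4 := zetaPos_ne_zero
  have h5 : zetaNeg ≠ 0 := by rw [zetaNeg_eq_inv]; exact inv_ne_zero h4
  obtain ⟨a, b, c, d, h⟩ := exists_of_mem_NegGroup hA
  generalize negCoeff A 1 0 = u at h
  generalize negCoeff A 1 1 = v at h
  rw [P_inv_mul_mul_P h5]
  refine mk_mem_NegGroup (a := d) (b := -(PowerSeries.C v + PowerSeries.X * c))
    (c := -(PowerSeries.C u + PowerSeries.X * b)) (d := a) ?_ ?_ ?_ ?_ ?_
  on_goal 5 =>
    rw [← hdet, Matrix.det_fin_two, Matrix.det_fin_two]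
    simp
    field_simp
  all_goals
    try simp only [PowerSeries.coe_add, PowerSeries.coe_neg, PowerSeries.coe_mul, PowerSeries.coe_C,
      coe_X_eq_zetaPos]
    rw [h, zetaNeg_eq_inv]
    simp [-HahnSeries.C_apply, cst]
    try field_simp
    try ring

theorem P_inv_mul_mul_P_mem_PosGroup (hA : A ∈ PosGroup) :
    (P zetaPos)⁻¹ * A * P zetaPos ∈ PosGroup := by
  have hdet := hA.2
  have h4 := zetaPos_ne_zero
  obtain ⟨a, b, c, d, h⟩ := exists_of_mem_PosGroup hA
  generalize posCoeff A 1 0 = u at h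
  generalize posCoeff A 1 1 = v at h
  rw [P_inv_mul_mul_P h4]
  refine mk_mem_PosGroup (a := d) (b := -(PowerSeries.C v + PowerSeries.X * c))
    (c := -(PowerSeries.C u + PowerSeries.X * b)) (d := a) ?_ ?_ ?_ ?_ ?_
  on_goal 5 =>
    rw [← hdet, Matrix.det_fin_two, Matrix.det_fin_two]
    simp
    field_simp
  all_goals
    try simp only [PowerSeries.coe_add, PowerSeries.coe_neg, PowerSeries.coe_mul, PowerSeries.coe_C,
      coe_X_eq_zetaPos]
    rw [h]
    simp [-HahnSeries.C_apply, cst]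
    try field_simp
    try ring

theorem posCoeff_ofPosCoeff (W : ℕ → Fin 2 → ℂ) : posCoeff (ofPosCoeff W) = W := by
  funext n
  obtain ⟨k, rfl | rfl⟩ := Nat.even_or_odd' n
  · ext i
    fin_cases i <;> simp [posCoeff, ofPosCoeff, HahnSeries.ofPowerSeries_apply_coeff]
  · have h2 : (2 * k + 1) / 2 = k := by omega
    have h3 (f : Ser) : (zetaPos * f).coeff ((k : ℤ) + 1) = f.coeff k := by
      rw [zetaPos, HahnSeries.coeff_single_mul_add, one_mul]
    ext i
    fin_cases i <;> simp [posCoeff, ofPosCoeff, h2, h3, LaurentSeries.coeff_coe_powerSeries]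

theorem negCoeff_ofNegCoeff (W : ℕ → Fin 2 → ℂ) : negCoeff (ofNegCoeff W) = W := by
  funext n
  obtain ⟨k, rfl | rfl⟩ := Nat.even_or_odd' n
  · ext i
    fin_cases i <;> simp [negCoeff, ofNegCoeff]
  · have h2 : (2 * k + 1) / 2 = k := by omega
    have h3 (f : Ser) : (zetaNeg⁻¹ * f).coeff ((k : ℤ) + 1) = f.coeff k := by
      rw [zetaNeg_eq_inv, inv_inv, zetaPos, HahnSeries.coeff_single_mul_add, one_mul]
    ext i
    fin_cases i <;> simp [negCoeff, ofNegCoeff, h2, h3, LaurentSeries.coeff_coe_powerSeries]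

/-- Transferring coefficients from `Λⁿ` to `Λ⁻ⁿ` keeps the series but moves the factor `X` from the
lower left to the upper right entry: formally, conjugation by `diag(X^{1/2}, X^{-1/2})`. -/
theorem ofNegCoeff_posCoeff (hA : A ∈ PosGroup) :
    ofNegCoeff (posCoeff A) = !![A 0 0, zetaPos * A 0 1; zetaPos⁻¹ * A 1 0, A 1 1] := by
  obtain ⟨⟨W, hW, rfl⟩, -⟩ := hA
  rw [posCoeff_ofPosCoeff]
  simp [ofNegCoeff, ofPosCoeff, zetaNeg_eq_inv, zetaPos_ne_zero]

theorem ofPosCoeff_negCoeff (hA : A ∈ NegGroup) :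
    ofPosCoeff (negCoeff A) = !![A 0 0, zetaPos⁻¹ * A 0 1; zetaPos * A 1 0, A 1 1] := by
  obtain ⟨⟨W, hW, rfl⟩, -⟩ := hA
  rw [negCoeff_ofNegCoeff]
  simp [ofNegCoeff, ofPosCoeff, zetaNeg_eq_inv, zetaPos_ne_zero]

theorem ofNegCoeff_posCoeff_mem (hA : A ∈ PosGroup) : ofNegCoeff (posCoeff A) ∈ NegGroup := by
  refine ⟨⟨_, ?_, rfl⟩, ?_⟩
  · obtain ⟨⟨W, hW, rfl⟩, -⟩ := hA
    rw [posCoeff_ofPosCoeff, hW]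
  · have h4 := zetaPos_ne_zero
    rw [ofNegCoeff_posCoeff hA, ← hA.2, Matrix.det_fin_two, Matrix.det_fin_two]
    simp
    field_simp

theorem ofPosCoeff_negCoeff_mem (hA : A ∈ NegGroup) : ofPosCoeff (negCoeff A) ∈ PosGroup := by
  refine ⟨⟨_, ?_, rfl⟩, ?_⟩
  · obtain ⟨⟨W, hW, rfl⟩, -⟩ := hA
    rw [negCoeff_ofNegCoeff, hW]
  · have h4 := zetaPos_ne_zero
    rw [ofPosCoeff_negCoeff hA, ← hA.2, Matrix.det_fin_two, Matrix.det_fin_two]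
    simp
    field_simp

end Membership

/-! ### Weights of the coefficients under scaling -/

section Covariance

variable {l α β : ℂ} {A B : Mat}

theorem twist_mul_mul (l m a b c d : ℂ) (A B C : Mat) :
    twist l m a d (A * B * C) = twist l m a b A * twist l m b c B * twist l m c d C := by
  rw [twist_mul l m a c d, twist_mul l m a b c]

theorem coeff_C_mul_rescaleHom (m a : ℂ) (f : Ser) (n : ℤ) :
    (HahnSeries.C a * rescaleHom m f).coeff n = a * (Complex.exp m ^ n * f.coeff n) := by
  rw [HahnSeries.C_mul_eq_smul, HahnSeries.coeff_smul, smul_eq_mul, coeff_rescaleHom]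

/-- The upper right entry gets `λ^α` from each side, and its coefficient of `ζ⁻¹` one more `λ` from
the rescaling. -/
theorem negCoeff_one_zero_of_twist (h : twist l l α α B = A) :
    negCoeff A 1 0 = Complex.exp (α * l) ^ 2 * Complex.exp l * negCoeff B 1 0 := by
  rw [← h, negCoeff_one_zero, negCoeff_one_zero, twist_eq]
  simp only [of_apply, cons_val', cons_val_zero, cons_val_one, cst, coeff_C_mul_rescaleHom,
    zpow_one]
  ring

theorem negCoeff_one_one_of_twist (h : twist l l α α B = A) :
    negCoeff A 1 1 = (Complex.exp (α * l))⁻¹ ^ 2 * negCoeff B 1 1 := by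
  rw [← h, negCoeff_one_one, negCoeff_one_one, twist_eq]
  simp only [of_apply, cons_val', cons_val_zero, cons_val_one, cst, coeff_C_mul_rescaleHom,
    zpow_zero]
  ring

theorem posCoeff_one_zero_of_twist (h : twist l (-l) β β B = A) :
    posCoeff A 1 0 = Complex.exp (β * l) ^ 2 * posCoeff B 1 0 := by
  rw [← h, posCoeff_one_zero, posCoeff_one_zero, twist_eq]
  simp only [of_apply, cons_val', cons_val_zero, cons_val_one, cst, coeff_C_mul_rescaleHom,
    zpow_zero]
  ring

theorem posCoeff_one_one_of_twist (h : twist l (-l) β β B = A) :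
    posCoeff A 1 1 = (Complex.exp (β * l))⁻¹ ^ 2 * (Complex.exp l)⁻¹ * posCoeff B 1 1 := by
  rw [← h, posCoeff_one_one, posCoeff_one_one, twist_eq]
  simp only [of_apply, cons_val', cons_val_zero, cons_val_one, cst, coeff_C_mul_rescaleHom,
    zpow_one]
  rw [Complex.exp_neg]
  ring

theorem coeff_torus (z : ℂ) : (torus z 0 0).coeff 0 = z := by
  simp [torus, HahnSeries.C_apply]

namespace Triple

variable {g : Triple}

/-- The substitution `ζ ↦ λ⁻¹ζ` multiplies the variable of `g_{<0}` by `e^l` and that of `g_{>0}` by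
`e^{-l}`, hence the second arguments `l` and `-l`. -/
theorem isSimilar_iff : g.IsSimilar α β ↔ ∀ (x : Times) (l : ℂ),
    (∀ s ∈ Set.Icc (0 : ℝ) 1, scale (Complex.exp (s * l)) x ∈ g.dom) →
    twist l l α α (g.neg (scale (Complex.exp l) x)) = g.neg x ∧
    powH l α * g.zero (scale (Complex.exp l) x) * powH l (-β) = g.zero x ∧
    twist l (-l) β β (g.pos (scale (Complex.exp l) x)) = g.pos x := by
  simp only [IsSimilar, ← Complex.exp_neg, twist, rescale_eq_rescaleHom]

theorem IsGauss.ephi_ne_zero (hg : g.IsGauss) {x : Times} (hx : x ∈ g.dom) : g.ephi x ≠ 0 :=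
  (exists_of_mem_ZeroGroup (hg x hx).2.1).1

theorem IsGauss.zero_eq (hg : g.IsGauss) {x : Times} (hx : x ∈ g.dom) :
    g.zero x = torus (g.ephi x) :=
  (exists_of_mem_ZeroGroup (hg x hx).2.1).2

theorem ephi_of_similar (hg : g.IsGauss) {x y : Times} (hx : x ∈ g.dom)
    (h : powH l α * g.zero x * powH l (-β) = g.zero y) :
    g.ephi y = Complex.exp (α * l) * g.ephi x * (Complex.exp (β * l))⁻¹ := by
  rw [ephi, ← h, hg.zero_eq hx, powH_mul_torus_mul_powH, coeff_torus]

theorem powH_mul_torus_mul_powH_eq {a b z w : ℂ}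
    (h : Complex.exp (a * l) * z * (Complex.exp (b * l))⁻¹ = w) :
    powH l a * torus z * powH l (-b) = torus w := by
  rw [powH_mul_torus_mul_powH, h]

theorem scale_mem_of_path {D : Set Times} {x : Times}
    (h : ∀ s ∈ Set.Icc (0 : ℝ) 1, scale (Complex.exp (s * l)) x ∈ D) :
    scale (Complex.exp l) x ∈ D := by
  simpa using h 1 (by simp)

theorem mem_of_path {D : Set Times} {x : Times}
    (h : ∀ s ∈ Set.Icc (0 : ℝ) 1, scale (Complex.exp (s * l)) x ∈ D) : x ∈ D := by
  simpa [scale] using h 0 (by simp)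

theorem negT_scale (c : ℂ) (x : Times) : negT (scale c x) = scale c (negT x) := by
  ext <;> simp [negT, scale]

theorem negTbar_scale (c : ℂ) (x : Times) : negTbar (scale c x) = scale c (negTbar x) := by
  ext <;> simp [negTbar, scale]

theorem neg_scale (c : ℂ) (x : Times) : -(scale c x) = scale c (-x) := by
  ext <;> simp [scale]

theorem swap_scale (c : ℂ) (x : Times) : (scale c x).swap = scale c⁻¹ x.swap := by
  ext <;> simp [scale]

end Triple
end Covariance

/-! ### The six transformations -/

namespace Triple

variable {g : Triple} {α β : ℂ}

theorem sL0_isGauss (hg : g.IsGauss) : g.sL0.IsGauss := by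
  rintro x ⟨hx, hq⟩
  obtain ⟨hn, hz, hp⟩ := hg _ hx
  have he := hg.ephi_ne_zero hx
  refine ⟨GL0_mul_mul_S0_mem hn hq, ?_, GLbar0_mul_mem hp _ _⟩
  simp only [sL0]
  rw [hg.zero_eq hx, GL0_mul_torus_mul_inv hq he]
  exact torus_mem_ZeroGroup (div_ne_zero (neg_ne_zero.2 he) hq)

theorem sL1_isGauss (hg : g.IsGauss) : g.sL1.IsGauss := by
  rintro x ⟨hx, hq⟩
  obtain ⟨hn, hz, hp⟩ := hg _ hx
  have he := hg.ephi_ne_zero hx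
  refine ⟨GL1_mul_mul_S1_mem hn hq, ?_, GLbar1_mul_mem hp _ _⟩
  simp only [sL1]
  rw [hg.zero_eq hx, GL1_mul_torus_mul_inv hq he]
  exact torus_mem_ZeroGroup (neg_ne_zero.2 (mul_ne_zero hq he))

theorem sR0_isGauss (hg : g.IsGauss) : g.sR0.IsGauss := by
  rintro x ⟨hx, hq⟩
  obtain ⟨hn, hz, hp⟩ := hg _ hx
  have he := hg.ephi_ne_zero hx
  refine ⟨GR0_mul_mem hn _ _, ?_, GRbar0_mul_mul_S0_mem hp hq⟩
  simp only [sR0]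
  rw [hg.zero_eq hx, GR0_mul_torus_mul_inv hq he]
  exact torus_mem_ZeroGroup (div_ne_zero he hq)

theorem sR1_isGauss (hg : g.IsGauss) : g.sR1.IsGauss := by
  rintro x ⟨hx, hq⟩
  obtain ⟨hn, hz, hp⟩ := hg _ hx
  have he := hg.ephi_ne_zero hx
  refine ⟨GR1_mul_mem hn _ _, ?_, GRbar1_mul_mul_S1_mem hp hq⟩
  simp only [sR1]
  rw [hg.zero_eq hx, GR1_mul_torus_mul_inv hq he]
  exact torus_mem_ZeroGroup (mul_ne_zero hq he)

theorem torus_conj_P {z : ℂ} {x : Ser} (hx : x ≠ 0) :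
    (P x)⁻¹ * torus z * P x = torus z⁻¹ := by
  rw [P_inv_mul_mul_P hx]
  simp [torus]

theorem dynkin_isGauss (hg : g.IsGauss) : g.dynkin.IsGauss := by
  intro x hx
  obtain ⟨hn, hz, hp⟩ := hg _ hx
  refine ⟨P_inv_mul_mul_P_mem_NegGroup hn, ?_, P_inv_mul_mul_P_mem_PosGroup hp⟩
  simp only [dynkin]
  rw [hg.zero_eq hx, torus_conj_P zetaPos_ne_zero]
  exact torus_mem_ZeroGroup (inv_ne_zero (hg.ephi_ne_zero hx))

theorem sigma_isGauss (hg : g.IsGauss) : g.sigma.IsGauss := by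
  intro x hx
  obtain ⟨hn, hz, hp⟩ := hg _ hx
  refine ⟨ofNegCoeff_posCoeff_mem hp, ?_, ofPosCoeff_negCoeff_mem hn⟩
  simp only [sigma]
  rw [hg.zero_eq hx, torus_inv (hg.ephi_ne_zero hx)]
  exact torus_mem_ZeroGroup (inv_ne_zero (hg.ephi_ne_zero hx))

theorem sL0_isSimilar (hg : g.IsGauss) (h : g.IsSimilar α β) :
    g.sL0.IsSimilar (-α - 1) β := by
  rw [isSimilar_iff] at h ⊢
  intro x l hl
  have h1 := scale_mem_of_path hl
  have h0 := mem_of_path hl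
  simp only [sL0, Set.mem_ofPred_eq, negT_scale] at hl h1 h0 ⊢
  generalize negT x = y at *
  -- The sign change commutes with scaling, so a path in the new domain gives one in the old domain;
  -- `q ≠ 0` is needed only at its two ends.
  obtain ⟨hn, hz, hp⟩ := h y l fun s hs => (hl s hs).1
  generalize scale (Complex.exp l) y = y' at *
  have he' := hg.ephi_ne_zero h1.1
  have hq : g.q y = _ := negCoeff_one_zero_of_twist hn
  have he := ephi_of_similar hg h1.1 hz
  refine ⟨?_, ?_, ?_⟩
  -- The parameters run `-α-1 → α → α → -α-1` across the three factors.
  · rw [twist_mul_mul l l _ α α, hn, twist_GL0 h1.2, twist_S0_zetaNeg, hq]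
    rfl
  · rw [hg.zero_eq h1.1, hg.zero_eq h0.1, GL0_mul_torus_mul_inv h1.2 he',
      GL0_mul_torus_mul_inv h0.2 (hg.ephi_ne_zero h0.1)]
    apply powH_mul_torus_mul_powH_eq
    rw [he, hq, exp_neg_sub_one_mul]
    change _ = _ / (_ * g.q y')
    have := Complex.exp_ne_zero l
    have := Complex.exp_ne_zero (α * l)
    have := Complex.exp_ne_zero (β * l)
    have := h1.2
    field_simp
  · rw [twist_mul l (-l) β β, hp, twist_GLbar0 (α := α) h1.2, he, hq]
    rfl

theorem sL1_isSimilar (hg : g.IsGauss) (h : g.IsSimilar α β) : g.sL1.IsSimilar (-α) β := by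
  rw [isSimilar_iff] at h ⊢
  intro x l hl
  have h1 := scale_mem_of_path hl
  have h0 := mem_of_path hl
  simp only [sL1, Set.mem_ofPred_eq, negT_scale] at hl h1 h0 ⊢
  generalize negT x = y at *
  obtain ⟨hn, hz, hp⟩ := h y l fun s hs => (hl s hs).1
  generalize scale (Complex.exp l) y = y' at *
  have he' := hg.ephi_ne_zero h1.1
  have hq : g.r y = _ := negCoeff_one_one_of_twist hn
  have he := ephi_of_similar hg h1.1 hz
  refine ⟨?_, ?_, ?_⟩
  · rw [twist_mul_mul l l _ α α, hn, twist_GL1 h1.2, twist_S1, hq]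
    rfl
  · rw [hg.zero_eq h1.1, hg.zero_eq h0.1, GL1_mul_torus_mul_inv h1.2 he',
      GL1_mul_torus_mul_inv h0.2 (hg.ephi_ne_zero h0.1)]
    apply powH_mul_torus_mul_powH_eq
    rw [he, hq, exp_neg_mul]
    change _ = -((_ * g.r y') * _)
    have := Complex.exp_ne_zero (α * l)
    have := Complex.exp_ne_zero (β * l)
    field_simp
  · rw [twist_mul l (-l) β β, hp, twist_GLbar1 (α := α) h1.2 he', he, hq]
    rfl

theorem sR0_isSimilar (hg : g.IsGauss) (h : g.IsSimilar α β) :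
    g.sR0.IsSimilar α (-β - 1) := by
  rw [isSimilar_iff] at h ⊢
  intro x l hl
  have h1 := scale_mem_of_path hl
  have h0 := mem_of_path hl
  simp only [sR0, Set.mem_ofPred_eq, negTbar_scale] at hl h1 h0 ⊢
  generalize negTbar x = y at *
  obtain ⟨hn, hz, hp⟩ := h y l fun s hs => (hl s hs).1
  generalize scale (Complex.exp l) y = y' at *
  have he' := hg.ephi_ne_zero h1.1
  have hq : g.rbar y = _ := posCoeff_one_one_of_twist hp
  have he := ephi_of_similar hg h1.1 hz
  refine ⟨?_, ?_, ?_⟩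
  · rw [twist_mul l l α α, hn, twist_GR0 (β := β) h1.2, he, hq]
    rfl
  · rw [hg.zero_eq h1.1, hg.zero_eq h0.1, GR0_mul_torus_mul_inv h1.2 he',
      GR0_mul_torus_mul_inv h0.2 (hg.ephi_ne_zero h0.1)]
    apply powH_mul_torus_mul_powH_eq
    rw [he, hq, exp_neg_sub_one_mul]
    change _ = _ / (_ * g.rbar y')
    have := Complex.exp_ne_zero l
    have := Complex.exp_ne_zero (α * l)
    have := Complex.exp_ne_zero (β * l)
    have := h1.2
    field_simp
  · rw [twist_mul_mul l (-l) _ β β, hp, twist_GRbar0 h1.2, twist_S0_zetaPos, hq]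
    rfl

theorem sR1_isSimilar (hg : g.IsGauss) (h : g.IsSimilar α β) : g.sR1.IsSimilar α (-β) := by
  rw [isSimilar_iff] at h ⊢
  intro x l hl
  have h1 := scale_mem_of_path hl
  have h0 := mem_of_path hl
  simp only [sR1, Set.mem_ofPred_eq, negTbar_scale] at hl h1 h0 ⊢
  generalize negTbar x = y at *
  obtain ⟨hn, hz, hp⟩ := h y l fun s hs => (hl s hs).1
  generalize scale (Complex.exp l) y = y' at *
  have he' := hg.ephi_ne_zero h1.1
  have hq : g.qbar y = _ := posCoeff_one_zero_of_twist hp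
  have he := ephi_of_similar hg h1.1 hz
  refine ⟨?_, ?_, ?_⟩
  · rw [twist_mul l l α α, hn, twist_GR1 (β := β) h1.2 he', he, hq]
    rfl
  · rw [hg.zero_eq h1.1, hg.zero_eq h0.1, GR1_mul_torus_mul_inv h1.2 he',
      GR1_mul_torus_mul_inv h0.2 (hg.ephi_ne_zero h0.1)]
    apply powH_mul_torus_mul_powH_eq
    rw [he, hq, exp_neg_mul]
    change _ = (_ * g.qbar y') * _
    have := Complex.exp_ne_zero (α * l)
    have := Complex.exp_ne_zero (β * l)
    field_simp
  · rw [twist_mul_mul l (-l) _ β β, hp, twist_GRbar1 h1.2, twist_S1, hq]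
    rfl

theorem exp_neg_sub_half_mul (a l : ℂ) :
    Complex.exp ((-a - 1 / 2) * l) = (Complex.exp (a * l))⁻¹ * (Complex.exp (l / 2))⁻¹ := by
  rw [← Complex.exp_neg, ← Complex.exp_neg, ← Complex.exp_add]
  ring_nf

/-- Makes `λ^{1/2}` the common unit, so that the shifts by `1/2` become algebraic identities. -/
theorem exp_eq_sq (l : ℂ) : Complex.exp l = Complex.exp (l / 2) ^ 2 := by
  rw [← Complex.exp_nat_mul]
  congr 1
  push_cast
  ring

theorem dynkin_isSimilar (hg : g.IsGauss) (h : g.IsSimilar α β) :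
    g.dynkin.IsSimilar (-α - 1 / 2) (-β - 1 / 2) := by
  rw [isSimilar_iff] at h ⊢
  intro x l hl
  have h1 := scale_mem_of_path hl
  have h0 := mem_of_path hl
  simp only [dynkin, Set.mem_ofPred_eq, neg_scale] at hl h1 h0 ⊢
  generalize -x = y at *
  obtain ⟨hn, hz, hp⟩ := h y l hl
  generalize scale (Complex.exp l) y = y' at *
  have he := ephi_of_similar hg h1 hz
  have hx := zetaPos_ne_zero
  have hx' : zetaNeg ≠ 0 := by rw [zetaNeg_eq_inv]; exact inv_ne_zero hx
  have e1 := C_exp_ne_zero (l / 2)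
  have e2 := C_exp_ne_zero (α * l)
  have e3 := C_exp_ne_zero (β * l)
  refine ⟨?_, ?_, ?_⟩
  · rw [← hn, P_inv_mul_mul_P hx', P_inv_mul_mul_P hx', twist_eq, twist_eq, exp_neg_sub_half_mul,
      zetaNeg_eq_inv]
    simp [rescaleHom_zetaPos, -HahnSeries.C_apply, cst, exp_eq_sq l]
    refine ⟨⟨?_, ?_⟩, ?_, ?_⟩ <;> field_simp
  · rw [hg.zero_eq h1, hg.zero_eq h0, torus_conj_P hx, torus_conj_P hx]
    apply powH_mul_torus_mul_powH_eq
    rw [he, exp_neg_sub_half_mul, exp_neg_sub_half_mul]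
    have := Complex.exp_ne_zero (l / 2)
    field_simp
  · rw [← hp, P_inv_mul_mul_P hx, P_inv_mul_mul_P hx, twist_eq, twist_eq, exp_neg_sub_half_mul]
    simp [rescaleHom_zetaPos, -HahnSeries.C_apply, cst, Complex.exp_neg, exp_eq_sq l]
    refine ⟨⟨?_, ?_⟩, ?_, ?_⟩ <;> field_simp

theorem sigma_isSimilar (hg : g.IsGauss) (h : g.IsSimilar α β) :
    g.sigma.IsSimilar (-β - 1 / 2) (-α - 1 / 2) := by
  rw [isSimilar_iff] at h ⊢
  intro x l hl
  have h1 := scale_mem_of_path hl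
  have h0 := mem_of_path hl
  simp only [sigma, Set.mem_ofPred_eq, swap_scale, ← Complex.exp_neg, ← mul_neg] at hl h1 h0 ⊢
  generalize x.swap = y at *
  -- Exchanging `t` and `t̄` turns scaling by `λ` into scaling by `λ⁻¹`, so the hypothesis is used
  -- at `-l`; this reverses the signs of `α` and `β`.
  obtain ⟨hn, hz, hp⟩ := h y (-l) hl
  generalize scale (Complex.exp (-l)) y = y' at *
  have he := ephi_of_similar hg h1 hz
  have hx := zetaPos_ne_zero
  have e1 := C_exp_ne_zero (l / 2)
  have e2 := C_exp_ne_zero (α * l)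
  have e3 := C_exp_ne_zero (β * l)
  refine ⟨?_, ?_, ?_⟩
  · rw [ofNegCoeff_posCoeff (hg _ h1).2.2, ofNegCoeff_posCoeff (hg _ h0).2.2, ← hp, twist_eq,
      twist_eq, exp_neg_sub_half_mul]
    simp [rescaleHom_zetaPos, -HahnSeries.C_apply, cst, Complex.exp_neg, exp_eq_sq l]
    refine ⟨⟨?_, ?_⟩, ?_, ?_⟩ <;> field_simp
  · rw [hg.zero_eq h1, hg.zero_eq h0, torus_inv (hg.ephi_ne_zero h1),
      torus_inv (hg.ephi_ne_zero h0)]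
    apply powH_mul_torus_mul_powH_eq
    rw [he, exp_neg_sub_half_mul, exp_neg_sub_half_mul, mul_neg, mul_neg, Complex.exp_neg,
      Complex.exp_neg]
    have := Complex.exp_ne_zero (l / 2)
    field_simp
  · rw [ofPosCoeff_negCoeff (hg _ h1).1, ofPosCoeff_negCoeff (hg _ h0).1, ← hn, twist_eq,
      twist_eq, exp_neg_sub_half_mul]
    simp [rescaleHom_zetaPos, -HahnSeries.C_apply, cst, Complex.exp_neg, exp_eq_sq l]
    refine ⟨⟨?_, ?_⟩, ?_, ?_⟩ <;> field_simp

end Triple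

end MPLR

theorem theorem2 (g : MPLR.Triple) (hg : g.IsGauss) (α β : ℂ) (h : g.IsSimilar α β) :
    (g.sigma.IsGauss ∧ g.sigma.IsSimilar (-β - 1 / 2) (-α - 1 / 2)) ∧
    (g.sL0.IsGauss ∧ g.sL0.IsSimilar (-α - 1) β) ∧
    (g.sL1.IsGauss ∧ g.sL1.IsSimilar (-α) β) ∧
    (g.sR0.IsGauss ∧ g.sR0.IsSimilar α (-β - 1)) ∧
    (g.sR1.IsGauss ∧ g.sR1.IsSimilar α (-β)) ∧
    (g.dynkin.IsGauss ∧ g.dynkin.IsSimilar (-α - 1 / 2) (-β - 1 / 2)) :=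
  ⟨⟨MPLR.Triple.sigma_isGauss hg, MPLR.Triple.sigma_isSimilar hg h⟩,
    ⟨MPLR.Triple.sL0_isGauss hg, MPLR.Triple.sL0_isSimilar hg h⟩,
    ⟨MPLR.Triple.sL1_isGauss hg, MPLR.Triple.sL1_isSimilar hg h⟩,
    ⟨MPLR.Triple.sR0_isGauss hg, MPLR.Triple.sR0_isSimilar hg h⟩,
    ⟨MPLR.Triple.sR1_isGauss hg, MPLR.Triple.sR1_isSimilar hg h⟩,
    ⟨MPLR.Triple.dynkin_isGauss hg, MPLR.Triple.dynkin_isSimilar hg h⟩⟩
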